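/- All random variables live on a probability space $(\Omega,\mathcal F,\mathbb P)$. Let $\xi$ be a standard normal random variable. A standard triangular array (STA) is a family of real random variables $\{\xi_{n,k}\}_{n\ge 1,\,1\le k\le n}$ such that, for every $n$, the variables $\xi_{n,1},\dots,\xi_{n,n}$ are independent, $\mathbb E[\xi_{n,k}]=0$ for all $k$, and $\sum_{k=1}^n\mathbb E[\xi_{n,k}^2]=1$. It satisfies Feller's condition if $\lim_{n\to\infty}\max_{1\le k\le n}\mathbb E[\xi_{n,k}^2]=0$. Its Lindeberg index is $$\mathrm{Lin}(\{\xi_{n,k}\})=\sup_{\epsilon>0}\limsup_{n\to\infty}\sum_{k=1}^n\mathbb E\big[\xi_{n,k}^2;\,|\xi_{n,k}|>\epsilon\big].$$ For Borel probability measures $P,Q$ on $\mathbb R$ consider the Kolmogorov distance $K(P,Q)=\sup_{x\in\mathbb R}|P(-\infty,x]-Q(-\infty,x]|$; if $P,Q$ have finite first absolute moments, the Wasserstein distance $W(P,Q)=\inf_\pi\int_{\mathbb R\times\mathbb R}|x-y|\,d\pi(x,y)$, where $\pi$ runs over the Borel probability measures on $\mathbb R\times\mathbb R$ with first marginal $P$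 and second marginal $Q$; and, for $\lambda>0$, the parametrized Prokhorov distance $\rho_\lambda(P,Q)$, the infimum of all $\alpha>0$ such that $P[A]\le Q[A^{(\lambda\alpha)}]+\alpha$ for every Borel set $A\subset\mathbb R$, where $A^{(r)}=\{x\in\mathbb R:\inf_{a\in A}|x-a|\le r\}$. These distances are applied to random variables through their laws. For $d\in\{K,W\}\cup\{\rho_\lambda:\lambda>0\}$ put $$\lambda_d\Big(\sum_{k=1}^n\xi_{n,k}\to\xi\Big)=\limsup_{n\to\infty}d\Big(\xi,\sum_{k=1}^n\xi_{n,k}\Big),\qquad \lambda_P\Big(\sum_{k=1}^n\xi_{n,k}\to\xi\Big)=\sup_{\lambda>0}\lambda_{\rho_\lambda}\Big(\sum_{k=1}^n\xi_{n,k}\to\xi\Big).$$ Theorem. For each $\delta\in\{K,W,P\}$ there exists a universal constant $C_\delta>0$ such that $$\lambda_\delta\Big(\sum_{k=1}^n\xi_{n,k}\to\xi\Big)\le C_\delta\,\mathrm{Lin}(\{\xi_{n,k}\})$$ for all STA's $\{\xi_{n,k}\}$ satisfying Feller's condition. Moreover, one can take $C_K=1$, $C_W=8$ and $C_P=4$.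 -/

import Mathlib

open MeasureTheory ProbabilityTheory Filter Topology
open scoped ENNReal

namespace ApproxCLT

noncomputable section

/-- The Kolmogorov distance `sup_x |P(-∞, x] - Q(-∞, x]|` of two measures on the line. -/
def kolmogorov (P Q : Measure ℝ) : ℝ≥0∞ :=
  ⨆ x : ℝ, ENNReal.ofReal |P.real (Set.Iic x) - Q.real (Set.Iic x)|

/-- The Wasserstein distance: the infimum of `∫ |x - y| dπ(x, y)` over all Borel measures `π` on
`ℝ × ℝ` with first marginal `P` and second marginal `Q`. (If `P` is a probability measure, the
marginal condition forces `π` to be one as well.) -/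
def wasserstein (P Q : Measure ℝ) : ℝ≥0∞ :=
  ⨅ (π : Measure (ℝ × ℝ)) (_ : π.map Prod.fst = P ∧ π.map Prod.snd = Q),
    ∫⁻ z, edist z.1 z.2 ∂π

/-- The Prokhorov distance `ρ_l` with parameter `l`: the infimum of all real `α > 0` such that
`P A ≤ Q (A^(lα)) + α` for every Borel set `A`, where `A^(r) = {x | inf_{a ∈ A} |x - a| ≤ r}`
is Mathlib's closed thickening. -/
def prokhorov (l : ℝ) (P Q : Measure ℝ) : ℝ≥0∞ :=
  ⨅ (α : ℝ) (_ : 0 < α ∧ ∀ A : Set ℝ, MeasurableSet A →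
      P A ≤ Q (Metric.cthickening (l * α) A) + ENNReal.ofReal α),
    ENNReal.ofReal α

variable {Ω : Type*} [MeasurableSpace Ω]

/-- A standard triangular array. Row `n` consists of the variables `X n k`, `k : Fin n`;
the rows of the array are those with `n ≥ 1`, the row `n = 0` being empty. -/
structure IsStandardTriangularArray (X : (n : ℕ) → Fin n → Ω → ℝ) (μ : Measure Ω) : Prop where
  measurable : ∀ n k, Measurable (X n k)
  indep : ∀ n, iIndepFun (X n) μ
  /-- finite second moments, so that the integrals below are genuine expectations -/
  memLp_two : ∀ n k, MemLp (X n k) 2 μ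
  mean_eq_zero : ∀ n k, ∫ ω, X n k ω ∂μ = 0
  sum_second_moment : ∀ n, 1 ≤ n → ∑ k : Fin n, ∫ ω, X n k ω ^ 2 ∂μ = 1

/-- Feller's condition `max_{k ≤ n} E[X_{n,k}²] → 0`. -/
def FellerCondition (X : (n : ℕ) → Fin n → Ω → ℝ) (μ : Measure Ω) : Prop :=
  Tendsto (fun n : ℕ => ⨆ k : Fin n, ∫ ω, X n k ω ^ 2 ∂μ) atTop (𝓝 0)

/-- The Lindeberg index `sup_{ε > 0} limsup_n ∑_k E[X_{n,k}² ; |X_{n,k}| > ε]`. -/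
def lindebergIndex (X : (n : ℕ) → Fin n → Ω → ℝ) (μ : Measure Ω) : ℝ≥0∞ :=
  ⨆ (ε : ℝ) (_ : 0 < ε), limsup (fun n : ℕ =>
    ∑ k : Fin n, ∫⁻ ω in {ω | ε < |X n k ω|}, ENNReal.ofReal (X n k ω ^ 2) ∂μ) atTop

/-- `limsup_n d(ξ, ∑_k X_{n,k})`, where `d` is applied to the laws of the random variables. -/
def limsupDist (d : Measure ℝ → Measure ℝ → ℝ≥0∞) (ξ : Ω → ℝ)
    (X : (n : ℕ) → Fin n → Ω → ℝ) (μ : Measure Ω) : ℝ≥0∞ :=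
  limsup (fun n : ℕ => d (μ.map ξ) (μ.map (fun ω => ∑ k : Fin n, X n k ω))) atTop

end

end ApproxCLT

/-! The proof is Stein's method, with the constants read off from oscillations. For a Lipschitz test
function h, let f solve f'(x) - x f(x) = h(x) - E h(ξ). With S a row sum, E h(S) - E h(ξ) = E[f'(S)
- S f(S)]. Leaving out one summand at a time and expanding f to first order (`abs_stein_step_le`),
jumps beyond ε cost at most osc(f') times their second moment. Everything else costs at most K(ε +
max σ) in total, where K is a Lipschitz constant of f'. Feller's condition and a small ε make this
error negligible, which leaves osc(f') · Lin (`eventually_abs_integral_sub_le`). Since K depends on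
h only through its Lipschitz constant, the bound is uniform over such h, and smoothing a test
function does not affect the final constant.

It remains to bound osc(f'). Here f' is h minus its average against a probability kernel
(`steinDeriv_eq_sub_steinAvg`, `steinWeight_convex_comb`). The oscillation is at most 8L for
L-Lipschitz h, at most 2 for h with values in [0,1], and at most 1 if h is moreover antitone,
because the average is then antitone too (`steinAvg_antitone`). Ramps give the Kolmogorov bound, the
Kantorovich potential of the quantile coupling the Wasserstein bound, and thickened indicators the
Prokhorov bound. -/

namespace ApproxCLT

open scoped NNReal

/-! ### The standard normal law: density, tail and truncated moments. -/

/-- The standard normal law. -/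
noncomputable abbrev normalLaw : Measure ℝ := gaussianReal 0 1

/-- The standard normal density. -/
noncomputable abbrev normalPdf : ℝ → ℝ := gaussianPDFReal 0 1

lemma normalPdf_eq (x : ℝ) :
    normalPdf x = (√(2 * Real.pi))⁻¹ * Real.exp (-x ^ 2 / 2) := by
  simp [normalPdf, gaussianPDFReal]

lemma normalPdf_pos (x : ℝ) : 0 < normalPdf x := gaussianPDFReal_pos 0 1 x one_ne_zero

lemma normalPdf_neg (x : ℝ) : normalPdf (-x) = normalPdf x := by simp [normalPdf_eq]

lemma normalPdf_le_one (x : ℝ) : normalPdf x ≤ 1 := by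
  rw [normalPdf_eq]
  have h1 : (√(2 * Real.pi))⁻¹ ≤ 1 := by
    apply inv_le_one_of_one_le₀
    rw [Real.one_le_sqrt]
    linarith [Real.pi_gt_three]
  have h2 : Real.exp (-x ^ 2 / 2) ≤ 1 := by
    rw [Real.exp_le_one_iff]
    nlinarith [sq_nonneg x]
  exact mul_le_one₀ h1 (Real.exp_pos _).le h2

lemma hasDerivAt_normalPdf (x : ℝ) : HasDerivAt normalPdf (-x * normalPdf x) x := by
  have h : HasDerivAt (fun y : ℝ => (√(2 * Real.pi))⁻¹ * Real.exp (-y ^ 2 / 2))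
      ((√(2 * Real.pi))⁻¹ * (Real.exp (-x ^ 2 / 2) * (-(2 * x) / 2))) x := by
    have := ((((hasDerivAt_pow 2 x).fun_neg).div_const 2).exp).const_mul (√(2 * Real.pi))⁻¹
    simpa using this
  have e : normalPdf = fun y : ℝ => (√(2 * Real.pi))⁻¹ * Real.exp (-y ^ 2 / 2) :=
    funext normalPdf_eq
  rw [e]
  exact h.congr_deriv (by ring)

lemma continuous_normalPdf : Continuous normalPdf :=
  continuous_iff_continuousAt.2 fun x => (hasDerivAt_normalPdf x).continuousAt

lemma normalLaw_eq_withDensity :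
    normalLaw = volume.withDensity (fun x => ENNReal.ofReal (normalPdf x)) :=
  gaussianReal_of_var_ne_zero 0 one_ne_zero

lemma integrable_normalLaw_iff {g : ℝ → ℝ} :
    Integrable g normalLaw ↔ Integrable (fun x => normalPdf x * g x) := by
  rw [normalLaw_eq_withDensity, integrable_withDensity_iff_integrable_smul']
  · simp [ENNReal.toReal_ofReal (normalPdf_pos _).le]
  · exact (measurable_gaussianPDFReal 0 1).ennreal_ofReal
  · simp

lemma setIntegral_normalLaw {s : Set ℝ} (hs : MeasurableSet s) (g : ℝ → ℝ) :
    ∫ t in s, g t ∂normalLaw = ∫ t in s, normalPdf t * g t := by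
  rw [normalLaw_eq_withDensity, setIntegral_withDensity_eq_setIntegral_toReal_smul]
  · simp [ENNReal.toReal_ofReal (normalPdf_pos _).le]
  · exact (measurable_gaussianPDFReal 0 1).ennreal_ofReal
  · simp
  · exact hs

instance : NullSingletonClass normalLaw := nullSingletonClass_gaussianReal one_ne_zero

lemma hasDerivAt_setIntegral_Iic_normalLaw {g : ℝ → ℝ} (hg : Continuous g)
    (hi : Integrable g normalLaw) (x : ℝ) :
    HasDerivAt (fun x => ∫ t in Set.Iic x, g t ∂normalLaw) (normalPdf x * g x) x := by
  have hc : Continuous fun t => normalPdf t * g t := continuous_normalPdf.mul hg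
  have hi' := integrable_normalLaw_iff.1 hi
  have e : (fun x => ∫ t in Set.Iic x, g t ∂normalLaw) = fun x =>
      (∫ t in Set.Iic 0, normalPdf t * g t) + ∫ t in (0 : ℝ)..x, normalPdf t * g t := by
    funext y
    rw [setIntegral_normalLaw measurableSet_Iic,
      ← intervalIntegral.integral_Iic_sub_Iic hi'.integrableOn hi'.integrableOn]
    ring
  rw [e]
  exact (intervalIntegral.integral_hasDerivAt_right (hc.intervalIntegrable _ _)
    (hc.stronglyMeasurableAtFilter _ _) hc.continuousAt).const_add _

/-- The upper tail of the standard normal law. -/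
noncomputable def normalTail (x : ℝ) : ℝ := normalLaw.real (Set.Ioi x)

lemma normalTail_nonneg (x : ℝ) : 0 ≤ normalTail x := measureReal_nonneg

lemma normalTail_le_one (x : ℝ) : normalTail x ≤ 1 := measureReal_le_one

lemma normalLaw_real_Iic (x : ℝ) : normalLaw.real (Set.Iic x) = 1 - normalTail x := by
  rw [normalTail, ← Set.compl_Iic, probReal_compl_eq_one_sub measurableSet_Iic]
  ring

lemma normalTail_neg (x : ℝ) : normalTail (-x) = 1 - normalTail x := by
  rw [← normalLaw_real_Iic, normalTail]
  have h : normalLaw.map (fun x => -x) = normalLaw := by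
    simpa using gaussianReal_map_neg (μ := 0) (v := 1)
  conv_lhs => rw [← h]
  rw [map_measureReal_apply measurable_neg measurableSet_Ioi]
  have : (fun x : ℝ => -x) ⁻¹' Set.Ioi (-x) = Set.Iio x := by ext; simp
  rw [this]
  exact measureReal_congr Iio_ae_eq_Iic

lemma hasDerivAt_normalTail (x : ℝ) : HasDerivAt normalTail (-normalPdf x) x := by
  have h := hasDerivAt_setIntegral_Iic_normalLaw (g := fun _ => 1) continuous_const
    (integrable_const _) x
  have e : normalTail = fun x => 1 - ∫ _ in Set.Iic x, (1 : ℝ) ∂normalLaw := by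
    funext y
    simp [normalLaw_real_Iic]
  rw [e]
  simpa using h.const_sub 1

lemma integrable_id_normalLaw : Integrable (fun x : ℝ => x) normalLaw :=
  (memLp_id_gaussianReal 1).integrable le_rfl

lemma integrable_sq_normalLaw : Integrable (fun x : ℝ => x ^ 2) normalLaw :=
  (memLp_id_gaussianReal 2).integrable_sq

lemma integral_Ioi_of_hasDerivAt_integrable {u u' : ℝ → ℝ} (hu : ∀ x, HasDerivAt u (u' x) x)
    (hi : Integrable u) (hi' : Integrable u') (x : ℝ) : ∫ t in Set.Ioi x, u' t = - u x := by
  have ht : Tendsto u atTop (𝓝 0) :=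
    tendsto_zero_of_hasDerivAt_of_integrableOn_Ioi (a := x) (fun y _ => hu y)
      hi'.integrableOn hi.integrableOn
  rw [integral_Ioi_of_hasDerivAt_of_tendsto' (fun y _ => hu y) hi'.integrableOn ht, zero_sub]

lemma integral_Ioi_id_normalLaw (x : ℝ) : ∫ t in Set.Ioi x, t ∂normalLaw = normalPdf x := by
  rw [setIntegral_normalLaw measurableSet_Ioi]
  have h := integral_Ioi_of_hasDerivAt_integrable (u := fun t => -normalPdf t)
    (u' := fun t => normalPdf t * t) (fun t =>
      (hasDerivAt_normalPdf t).fun_neg.congr_deriv (by ring))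
    (integrable_gaussianPDFReal 0 1).neg (integrable_normalLaw_iff.1 integrable_id_normalLaw) x
  rw [h, neg_neg]

lemma integral_Ioi_sq_normalLaw (x : ℝ) :
    ∫ t in Set.Ioi x, t ^ 2 ∂normalLaw = x * normalPdf x + normalTail x := by
  have h := integral_Ioi_of_hasDerivAt_integrable (u := fun t => -(normalPdf t * t))
    (u' := fun t => normalPdf t * (t ^ 2 - 1)) (fun t =>
      ((hasDerivAt_normalPdf t).fun_mul (hasDerivAt_id' t)).fun_neg.congr_deriv (by ring))
    (integrable_normalLaw_iff.1 integrable_id_normalLaw).neg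
    (integrable_normalLaw_iff.1 (integrable_sq_normalLaw.sub (integrable_const 1))) x
  rw [← setIntegral_normalLaw measurableSet_Ioi (fun t => t ^ 2 - 1),
    integral_sub integrable_sq_normalLaw.integrableOn (integrable_const 1)] at h
  simp only [integral_const, smul_eq_mul, mul_one, measureReal_restrict_apply_univ] at h
  rw [normalTail]
  linarith

/-! ### The Stein weight and Mills ratio estimates. -/

/-- The weight `1 - x Φ̄(x) / φ(x)` given to the lower half-line by the Stein kernel. -/
noncomputable def steinWeight (x : ℝ) : ℝ := 1 - x * normalTail x / normalPdf x

lemma normalPdf_mul_steinWeight (x : ℝ) :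
    normalPdf x * steinWeight x = normalPdf x - x * normalTail x := by
  have := (normalPdf_pos x).ne'
  rw [steinWeight]
  field_simp

/-- Identifies φ(x) times the weight with E(ξ - x)⁺. This yields positivity of the weight, and it is
the quantity that a Lipschitz increment of h integrates to. -/
lemma integral_Ioi_sub_normalLaw (x : ℝ) :
    ∫ t in Set.Ioi x, (t - x) ∂normalLaw = normalPdf x * steinWeight x := by
  rw [normalPdf_mul_steinWeight, integral_sub integrable_id_normalLaw.integrableOn
    (integrable_const _), integral_Ioi_id_normalLaw]
  simp only [integral_const, smul_eq_mul, measureReal_restrict_apply_univ, normalTail]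
  ring

lemma integral_Iic_sub_normalLaw (x : ℝ) :
    ∫ t in Set.Iic x, (x - t) ∂normalLaw = normalPdf x * steinWeight (-x) := by
  have h := integral_add_compl (s := Set.Iic x) measurableSet_Iic
    ((integrable_const x).sub integrable_id_normalLaw)
  have h0 : ∫ t, (x - t) ∂normalLaw = x := by
    rw [integral_sub (integrable_const x) integrable_id_normalLaw]
    simp [normalLaw]
  have h1 := integral_Ioi_sub_normalLaw x
  have h2 : ∫ t in Set.Ioi x, (x - t) ∂normalLaw = -(normalPdf x * steinWeight x) := by
    rw [← h1, ← integral_neg]; simp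
  have h3 := normalPdf_mul_steinWeight (-x)
  rw [normalPdf_neg, normalTail_neg] at h3
  simp only [Pi.sub_apply, Set.compl_Iic] at h
  rw [h0, h2] at h
  rw [h3]
  rw [normalPdf_mul_steinWeight] at h
  linarith

lemma steinWeight_nonneg (x : ℝ) : 0 ≤ steinWeight x := by
  have h : 0 ≤ normalPdf x * steinWeight x := by
    rw [← integral_Ioi_sub_normalLaw]
    exact setIntegral_nonneg measurableSet_Ioi fun t ht => sub_nonneg.2 (le_of_lt ht)
  exact nonneg_of_mul_nonneg_right h (normalPdf_pos x)

/-- The Gordon inequality for the Mills ratio. -/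
lemma mul_normalPdf_le (x : ℝ) : x * normalPdf x ≤ (1 + x ^ 2) * normalTail x := by
  -- The inequality is the nonnegativity of E[((ξ - x)⁺)²], expanded.
  have h : 0 ≤ ∫ t in Set.Ioi x, (t - x) ^ 2 ∂normalLaw :=
    integral_nonneg fun t => sq_nonneg _
  have e : ∫ t in Set.Ioi x, (t - x) ^ 2 ∂normalLaw =
      (x * normalPdf x + normalTail x) - 2 * x * normalPdf x + x ^ 2 * normalTail x := by
    have i1 : Integrable (fun t : ℝ => t ^ 2) (normalLaw.restrict (Set.Ioi x)) :=
      integrable_sq_normalLaw.integrableOn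
    have i2 : Integrable (fun t : ℝ => 2 * x * t) (normalLaw.restrict (Set.Ioi x)) :=
      (integrable_id_normalLaw.const_mul (2 * x)).integrableOn
    calc ∫ t in Set.Ioi x, (t - x) ^ 2 ∂normalLaw
        = ∫ t in Set.Ioi x, (t ^ 2 - 2 * x * t + x ^ 2) ∂normalLaw := by
          congr 1; funext t; ring
      _ = _ := by
          rw [integral_add (by exact i1.sub i2) (integrable_const _), integral_sub i1 i2,
            integral_const_mul, integral_Ioi_id_normalLaw, integral_Ioi_sq_normalLaw]
          simp only [integral_const, smul_eq_mul, measureReal_restrict_apply_univ, normalTail]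
          ring
  rw [e] at h
  linarith

lemma hasDerivAt_steinWeight (x : ℝ) :
    HasDerivAt steinWeight ((x * normalPdf x - (1 + x ^ 2) * normalTail x) / normalPdf x) x := by
  have hp := (normalPdf_pos x).ne'
  have h := (((hasDerivAt_id' x).fun_mul (hasDerivAt_normalTail x)).fun_div
    (hasDerivAt_normalPdf x) hp).const_sub 1
  refine h.congr_deriv ?_
  field_simp
  ring

lemma steinWeight_antitone : Antitone steinWeight := by
  apply antitone_of_hasDerivAt_nonpos hasDerivAt_steinWeight
  intro x
  exact div_nonpos_of_nonpos_of_nonneg (by linarith [mul_normalPdf_le x]) (normalPdf_pos x).le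

/-- Gordon's inequality multiplied by x. The quadratic decay is what keeps both the kernel bound and
its multiple by x finite. -/
lemma steinWeight_le {x : ℝ} (hx : 0 ≤ x) : steinWeight x * (1 + x ^ 2) ≤ 1 := by
  have hp := normalPdf_pos x
  have h := mul_le_mul_of_nonneg_left (mul_normalPdf_le x) hx
  have h1 := normalPdf_mul_steinWeight x
  have h2 : normalPdf x * (steinWeight x * (1 + x ^ 2)) ≤ normalPdf x * 1 := by
    have : normalPdf x * (steinWeight x * (1 + x ^ 2)) =
      (normalPdf x - x * normalTail x) * (1 + x ^ 2) := by rw [← h1]; ring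
    rw [this]
    nlinarith
  exact le_of_mul_le_mul_left h2 hp

/-- The Stein kernel at x has total normal mass one, so that `steinAvg` is a genuine average. -/
lemma steinWeight_convex_comb (x : ℝ) :
    steinWeight x * (1 - normalTail x) + steinWeight (-x) * normalTail x = 1 := by
  rw [steinWeight, steinWeight, normalPdf_neg, normalTail_neg]
  ring

/-- `φ A B` is bounded, even after multiplication by `x`. -/
lemma stein_kernel_bound (x : ℝ) :
    2 * (normalPdf x * steinWeight x * steinWeight (-x)) ≤ 4 ∧
      |x| * (2 * (normalPdf x * steinWeight x * steinWeight (-x))) ≤ 4 := by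
  wlog hx : 0 ≤ x generalizing x
  -- The kernel is even in x.
  · have := this (-x) (by linarith)
    rw [normalPdf_neg, abs_neg, neg_neg] at this
    convert this using 3 <;> ring
  have hA := steinWeight_nonneg x
  have hA1 := steinWeight_le hx
  have hB : normalPdf x * steinWeight (-x) ≤ 1 + x := by
    have h := normalPdf_mul_steinWeight (-x)
    rw [normalPdf_neg, normalTail_neg] at h
    rw [h]
    nlinarith [normalTail_nonneg x, normalPdf_le_one x]
  have h1 : normalPdf x * steinWeight x * steinWeight (-x) ≤ steinWeight x * (1 + x) := by
    have := mul_le_mul_of_nonneg_left hB hA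
    linarith
  rw [abs_of_nonneg hx]
  constructor
  · nlinarith [mul_nonneg hA (sq_nonneg (x - 1))]
  · have := mul_le_mul_of_nonneg_left h1 hx
    nlinarith [mul_nonneg hA (sq_nonneg (x - 1)), mul_nonneg hA hx]

/-! ### The Stein equation and representations of its solution. -/

lemma integrable_of_lipschitzWith {ν : Measure ℝ} [IsFiniteMeasure ν]
    (hid : Integrable (fun x : ℝ => x) ν) {h : ℝ → ℝ} {L : ℝ≥0} (hh : LipschitzWith L h) :
    Integrable h ν := by
  refine ((integrable_const |h 0|).add (hid.abs.const_mul (L : ℝ))).mono'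
    hh.continuous.aestronglyMeasurable (ae_of_all _ fun x => ?_)
  have h1 := hh.dist_le_mul x 0
  rw [Real.dist_eq, Real.dist_eq, sub_zero] at h1
  have h2 := abs_sub_abs_le_abs_sub (h x) (h 0)
  simp only [Real.norm_eq_abs, Pi.add_apply]
  linarith

/-- The bounded solution `f` of the Stein equation `f' x - x f x = h x - E h(ξ)`. -/
noncomputable def steinSol (h : ℝ → ℝ) (x : ℝ) : ℝ :=
  (∫ t in Set.Iic x, (h t - ∫ s, h s ∂normalLaw) ∂normalLaw) / normalPdf x

/-- The derivative of `steinSol h`. -/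
noncomputable def steinDeriv (h : ℝ → ℝ) (x : ℝ) : ℝ :=
  h x - (∫ s, h s ∂normalLaw) + x * steinSol h x

lemma hasDerivAt_steinSol {h : ℝ → ℝ} (hc : Continuous h) (hi : Integrable h normalLaw) (x : ℝ) :
    HasDerivAt (steinSol h) (steinDeriv h x) x := by
  have hp := (normalPdf_pos x).ne'
  have h1 := (hasDerivAt_setIntegral_Iic_normalLaw (g := fun t => h t - ∫ s, h s ∂normalLaw)
    (by fun_prop) (hi.sub (integrable_const _)) x).fun_div (hasDerivAt_normalPdf x) hp
  refine h1.congr_deriv ?_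
  rw [steinDeriv, steinSol]
  field_simp
  ring

lemma setIntegral_sub_const_normalLaw {h : ℝ → ℝ} (hi : Integrable h normalLaw) (s : Set ℝ)
    (c : ℝ) : ∫ t in s, (h t - c) ∂normalLaw
      = ∫ t in s, h t ∂normalLaw - c * normalLaw.real s := by
  rw [integral_sub hi.integrableOn (integrable_const _)]
  simp [mul_comm]

lemma integral_Iic_add_Ioi_normalLaw {h : ℝ → ℝ} (hi : Integrable h normalLaw) (x : ℝ) :
    ∫ t in Set.Iic x, h t ∂normalLaw + ∫ t in Set.Ioi x, h t ∂normalLaw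
      = ∫ t, h t ∂normalLaw := by
  rw [← Set.compl_Iic]
  exact integral_add_compl measurableSet_Iic hi

/-- Recentring at h x instead of the mean leaves only increments of h, to which a Lipschitz bound
applies. -/
lemma steinSol_eq {h : ℝ → ℝ} (hi : Integrable h normalLaw) (x : ℝ) :
    steinSol h x = (normalTail x * ∫ t in Set.Iic x, (h t - h x) ∂normalLaw
      - (1 - normalTail x) * ∫ t in Set.Ioi x, (h t - h x) ∂normalLaw) / normalPdf x := by
  rw [steinSol, setIntegral_sub_const_normalLaw hi, setIntegral_sub_const_normalLaw hi,
    setIntegral_sub_const_normalLaw hi, normalLaw_real_Iic, ← integral_Iic_add_Ioi_normalLaw hi x]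
  congr 1
  rw [← normalTail]
  ring

/-- The average of `h` against the Stein kernel at `x`. -/
noncomputable def steinAvg (h : ℝ → ℝ) (x : ℝ) : ℝ :=
  steinWeight x * ∫ t in Set.Iic x, h t ∂normalLaw
    + steinWeight (-x) * ∫ t in Set.Ioi x, h t ∂normalLaw

lemma steinDeriv_eq_sub_steinAvg {h : ℝ → ℝ} (hi : Integrable h normalLaw) (x : ℝ) :
    steinDeriv h x = h x - steinAvg h x := by
  rw [steinDeriv, steinSol, steinAvg, setIntegral_sub_const_normalLaw hi, normalLaw_real_Iic,
    ← integral_Iic_add_Ioi_normalLaw hi x, steinWeight, steinWeight, normalPdf_neg, normalTail_neg]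
  ring

lemma steinDeriv_eq {h : ℝ → ℝ} (hi : Integrable h normalLaw) (x : ℝ) :
    steinDeriv h x = -(steinWeight x * ∫ t in Set.Iic x, (h t - h x) ∂normalLaw
      + steinWeight (-x) * ∫ t in Set.Ioi x, (h t - h x) ∂normalLaw) := by
  rw [steinDeriv_eq_sub_steinAvg hi, steinAvg, setIntegral_sub_const_normalLaw hi,
    setIntegral_sub_const_normalLaw hi, normalLaw_real_Iic, ← normalTail]
  linear_combination -h x * steinWeight_convex_comb x

/-! ### Bounds on the Stein solution for Lipschitz test functions. -/

section Lipschitz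

variable {h : ℝ → ℝ} {L : ℝ≥0}

lemma integrable_normalLaw_of_lipschitzWith (hh : LipschitzWith L h) : Integrable h normalLaw :=
  integrable_of_lipschitzWith integrable_id_normalLaw hh

lemma abs_integral_Iic_sub_le (hh : LipschitzWith L h) (x : ℝ) :
    |∫ t in Set.Iic x, (h t - h x) ∂normalLaw| ≤ L * (normalPdf x * steinWeight (-x)) := by
  rw [← integral_Iic_sub_normalLaw, ← integral_const_mul, ← Real.norm_eq_abs]
  refine norm_integral_le_of_norm_le (((integrable_const x).sub
    integrable_id_normalLaw).const_mul (L : ℝ)).integrableOn ?_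
  filter_upwards [ae_restrict_mem measurableSet_Iic] with t ht
  have h1 := hh.dist_le_mul t x
  rwa [Real.dist_eq, Real.dist_eq, abs_sub_comm t x,
    abs_of_nonneg (sub_nonneg.2 (Set.mem_Iic.1 ht))] at h1

lemma abs_integral_Ioi_sub_le (hh : LipschitzWith L h) (x : ℝ) :
    |∫ t in Set.Ioi x, (h t - h x) ∂normalLaw| ≤ L * (normalPdf x * steinWeight x) := by
  rw [← integral_Ioi_sub_normalLaw, ← integral_const_mul, ← Real.norm_eq_abs]
  refine norm_integral_le_of_norm_le ((integrable_id_normalLaw.sub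
    (integrable_const x)).const_mul (L : ℝ)).integrableOn ?_
  filter_upwards [ae_restrict_mem measurableSet_Ioi] with t ht
  have h1 := hh.dist_le_mul t x
  rwa [Real.dist_eq, Real.dist_eq,
    abs_of_nonneg (sub_nonneg.2 (le_of_lt (Set.mem_Ioi.1 ht)))] at h1

lemma abs_steinSol_le (hh : LipschitzWith L h) (x : ℝ) : |steinSol h x| ≤ L := by
  have hp := normalPdf_pos x
  rw [steinSol_eq (integrable_normalLaw_of_lipschitzWith hh), abs_div, abs_of_pos hp,
    div_le_iff₀ hp]
  have h0 := normalTail_nonneg x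
  have h1 := sub_nonneg.2 (normalTail_le_one x)
  refine (abs_sub _ _).trans ?_
  rw [abs_mul, abs_mul, abs_of_nonneg h0, abs_of_nonneg h1]
  have e1 := mul_le_mul_of_nonneg_left (abs_integral_Iic_sub_le hh x) h0
  have e2 := mul_le_mul_of_nonneg_left (abs_integral_Ioi_sub_le hh x) h1
  -- The two half-line bounds recombine exactly, because the kernel has mass one.
  have e3 : (L : ℝ) * normalPdf x = normalTail x * (L * (normalPdf x * steinWeight (-x)))
      + (1 - normalTail x) * (L * (normalPdf x * steinWeight x)) := by
    linear_combination (-(L : ℝ) * normalPdf x) * steinWeight_convex_comb x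
  linarith

lemma abs_steinDeriv_le_kernel (hh : LipschitzWith L h) (x : ℝ) :
    |steinDeriv h x| ≤ L * (2 * (normalPdf x * steinWeight x * steinWeight (-x))) := by
  rw [steinDeriv_eq (integrable_normalLaw_of_lipschitzWith hh), abs_neg]
  have h0 := steinWeight_nonneg x
  have h1 := steinWeight_nonneg (-x)
  refine (abs_add_le _ _).trans ?_
  rw [abs_mul, abs_mul, abs_of_nonneg h0, abs_of_nonneg h1]
  have e1 := mul_le_mul_of_nonneg_left (abs_integral_Iic_sub_le hh x) h0
  have e2 := mul_le_mul_of_nonneg_left (abs_integral_Ioi_sub_le hh x) h1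
  linarith

lemma abs_steinDeriv_le (hh : LipschitzWith L h) (x : ℝ) : |steinDeriv h x| ≤ 4 * L := by
  have := mul_le_mul_of_nonneg_left (stein_kernel_bound x).1 L.coe_nonneg
  linarith [abs_steinDeriv_le_kernel hh x]

lemma abs_mul_steinDeriv_le (hh : LipschitzWith L h) (x : ℝ) :
    |x * steinDeriv h x| ≤ 4 * L := by
  have h1 := mul_le_mul_of_nonneg_left (stein_kernel_bound x).2 L.coe_nonneg
  have h2 := mul_le_mul_of_nonneg_left (abs_steinDeriv_le_kernel hh x) (abs_nonneg x)
  rw [abs_mul]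
  linarith

/-- By the Stein equation f' is h plus x f plus a constant, and (x f)' = f + x f' is at most L + 4L.
No differentiability of h is needed. -/
lemma lipschitzWith_steinDeriv (hh : LipschitzWith L h) :
    LipschitzWith (6 * L) (steinDeriv h) := by
  have hd : ∀ x, HasDerivAt (fun x => x * steinSol h x) (steinSol h x + x * steinDeriv h x) x :=
    fun x => ((hasDerivAt_id' x).fun_mul (hasDerivAt_steinSol hh.continuous
      (integrable_normalLaw_of_lipschitzWith hh) x)).congr_deriv (by ring)
  have hl : LipschitzWith (5 * L) (fun x => x * steinSol h x) := by
    refine lipschitzWith_of_nnnorm_deriv_le (fun x => (hd x).differentiableAt) fun x => ?_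
    rw [← NNReal.coe_le_coe, coe_nnnorm, (hd x).deriv]
    push_cast
    have := abs_add_le (steinSol h x) (x * steinDeriv h x)
    rw [Real.norm_eq_abs]
    linarith [abs_steinSol_le hh x, abs_mul_steinDeriv_le hh x]
  have e : 6 * L = L + 0 + 5 * L := by ring
  rw [e]
  exact (hh.sub (LipschitzWith.const (∫ s, h s ∂normalLaw))).add hl

lemma abs_steinDeriv_sub_le (hh : LipschitzWith L h) (x y : ℝ) :
    |steinDeriv h x - steinDeriv h y| ≤ 8 * L := by
  have := abs_sub (steinDeriv h x) (steinDeriv h y)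
  linarith [abs_steinDeriv_le hh x, abs_steinDeriv_le hh y]

end Lipschitz

/-! ### Oscillation of the derivative for test functions with values in [0,1]. -/

lemma steinAvg_mem_Icc {h : ℝ → ℝ} (hi : Integrable h normalLaw)
    (h01 : ∀ t, h t ∈ Set.Icc (0 : ℝ) 1) (x : ℝ) : steinAvg h x ∈ Set.Icc (0 : ℝ) 1 := by
  have h0 := steinWeight_nonneg x
  have h1 := steinWeight_nonneg (-x)
  have hs : ∀ s : Set ℝ, 0 ≤ ∫ t in s, h t ∂normalLaw ∧
      ∫ t in s, h t ∂normalLaw ≤ normalLaw.real s := fun s =>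
    ⟨integral_nonneg fun t => (h01 t).1, by
      have := integral_mono (μ := normalLaw.restrict s) hi.integrableOn (integrable_const 1)
        fun t => (h01 t).2
      simpa using this⟩
  obtain ⟨a0, a1⟩ := hs (Set.Iic x)
  obtain ⟨b0, b1⟩ := hs (Set.Ioi x)
  rw [normalLaw_real_Iic] at a1
  rw [← normalTail] at b1
  have := steinWeight_convex_comb x
  rw [steinAvg]
  exact ⟨by positivity, by
    linarith [mul_le_mul_of_nonneg_left a1 h0, mul_le_mul_of_nonneg_left b1 h1]⟩

lemma abs_steinDeriv_sub_le_of_mem_Icc {h : ℝ → ℝ} (hi : Integrable h normalLaw)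
    (h01 : ∀ t, h t ∈ Set.Icc (0 : ℝ) 1) (x y : ℝ) :
    |steinDeriv h x - steinDeriv h y| ≤ 2 := by
  rw [steinDeriv_eq_sub_steinAvg hi, steinDeriv_eq_sub_steinAvg hi]
  obtain ⟨a0, a1⟩ := steinAvg_mem_Icc hi h01 x
  obtain ⟨b0, b1⟩ := steinAvg_mem_Icc hi h01 y
  obtain ⟨c0, c1⟩ := h01 x
  obtain ⟨d0, d1⟩ := h01 y
  rw [abs_le]
  constructor <;> linarith

/-- Moving from x to y ≥ x lowers the kernel on (-∞, x] and raises it on (y, ∞), as the weight is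
antitone. Whatever the sign on (x, y], the change has one sign switch and total mass zero: mass
moves to the right, so averages of antitone functions decrease. -/
lemma steinAvg_antitone {h : ℝ → ℝ} (hi : Integrable h normalLaw) (hanti : Antitone h) :
    Antitone (steinAvg h) := by
  intro x y hxy
  have lower : ∀ (s : Set ℝ) (c : ℝ), MeasurableSet s → (∀ t ∈ s, c ≤ h t) →
      c * normalLaw.real s ≤ ∫ t in s, h t ∂normalLaw := fun s c hs hc => by
    have : 0 ≤ ∫ t in s, (h t - c) ∂normalLaw :=
      setIntegral_nonneg hs fun t ht => sub_nonneg.2 (hc t ht)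
    rw [setIntegral_sub_const_normalLaw hi] at this
    linarith
  have upper : ∀ (s : Set ℝ) (c : ℝ), MeasurableSet s → (∀ t ∈ s, h t ≤ c) →
      ∫ t in s, h t ∂normalLaw ≤ c * normalLaw.real s := fun s c hs hc => by
    have : ∫ t in s, (h t - c) ∂normalLaw ≤ 0 :=
      setIntegral_nonpos hs fun t ht => sub_nonpos.2 (hc t ht)
    rw [setIntegral_sub_const_normalLaw hi] at this
    linarith
  have split : ∀ g : ℝ → ℝ, Integrable g normalLaw → ∫ t in Set.Iic y, g t ∂normalLaw =
      ∫ t in Set.Iic x, g t ∂normalLaw + ∫ t in Set.Ioc x y, g t ∂normalLaw := fun g hg => by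
    rw [← Set.Iic_union_Ioc_eq_Iic hxy, setIntegral_union (Set.Iic_disjoint_Ioc le_rfl)
      measurableSet_Ioc hg.integrableOn hg.integrableOn]
  have eIic := split h hi
  have mIic := split (fun _ => 1) (integrable_const 1)
  simp only [integral_const, smul_eq_mul, mul_one, measureReal_restrict_apply_univ,
    normalLaw_real_Iic] at mIic
  have tx := integral_Iic_add_Ioi_normalLaw hi x
  have ty := integral_Iic_add_Ioi_normalLaw hi y
  have cx := steinWeight_convex_comb x
  have cy := steinWeight_convex_comb y
  have p := lower (Set.Iic x) (h x) measurableSet_Iic fun t ht => hanti ht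
  have q1 := lower (Set.Ioc x y) (h y) measurableSet_Ioc fun t ht => hanti ht.2
  have q2 := upper (Set.Ioc x y) (h x) measurableSet_Ioc fun t ht => hanti ht.1.le
  have r := upper (Set.Ioi y) (h y) measurableSet_Ioi fun t ht => hanti (le_of_lt ht)
  have hA : 0 ≤ steinWeight x - steinWeight y := sub_nonneg.2 (steinWeight_antitone hxy)
  have hB : 0 ≤ steinWeight (-y) - steinWeight (-x) :=
    sub_nonneg.2 (steinWeight_antitone (neg_le_neg hxy))
  have hh := hanti hxy
  have m1 : 0 ≤ normalLaw.real (Set.Iic x) := measureReal_nonneg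
  have m2 : 0 ≤ normalLaw.real (Set.Ioi y) := measureReal_nonneg
  rw [normalLaw_real_Iic] at p m1
  rw [← normalTail] at r m2
  simp only [steinAvg]
  have hJ : ∫ t in Set.Ioi x, h t ∂normalLaw =
      ∫ t in Set.Ioc x y, h t ∂normalLaw + ∫ t in Set.Ioi y, h t ∂normalLaw := by linarith
  rw [hJ, eIic]
  generalize ∫ t in Set.Iic x, h t ∂normalLaw = I₁ at *
  generalize ∫ t in Set.Ioc x y, h t ∂normalLaw = I₂ at *
  generalize ∫ t in Set.Ioi y, h t ∂normalLaw = I₃ at *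
  rw [← sub_nonneg]
  have hq : normalLaw.real (Set.Ioc x y) = normalTail x - normalTail y := by linarith
  rw [hq] at q1 q2
  -- The sign of the change on (x, y] decides where the switch lies: at y, where h is compared with
  -- h y, or at x, where it is compared with h x. The constants cancel by `cx` and `cy`.
  rcases le_total (steinWeight y) (steinWeight (-x)) with hc | hc
  · have k1 := mul_le_mul_of_nonneg_left
      ((mul_le_mul_of_nonneg_right hh m1).trans p) hA
    have k2 := mul_le_mul_of_nonneg_left q1 (sub_nonneg.2 hc)
    have k3 := mul_le_mul_of_nonneg_left r hB
    linear_combination k1 + k2 + k3 - h y * cx + h y * cy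
  · have k1 := mul_le_mul_of_nonneg_left p hA
    have k2 := mul_le_mul_of_nonneg_left q2 (sub_nonneg.2 hc)
    have k3 := mul_le_mul_of_nonneg_left (r.trans (mul_le_mul_of_nonneg_right hh m2)) hB
    linear_combination k1 + k2 + k3 - h x * cx + h x * cy

/-- For x ≤ y, both h x - h y and the drop of the average lie in [0,1], and the increment of f' is
their difference. -/
lemma abs_steinDeriv_sub_le_of_antitone {h : ℝ → ℝ} (hi : Integrable h normalLaw)
    (h01 : ∀ t, h t ∈ Set.Icc (0 : ℝ) 1) (hanti : Antitone h) (x y : ℝ) :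
    |steinDeriv h x - steinDeriv h y| ≤ 1 := by
  wlog hxy : x ≤ y generalizing x y
  · rw [abs_sub_comm]
    exact this y x (le_of_not_ge hxy)
  rw [steinDeriv_eq_sub_steinAvg hi, steinDeriv_eq_sub_steinAvg hi]
  have a := (steinAvg_mem_Icc hi h01 x).2
  have b := (steinAvg_mem_Icc hi h01 y).1
  have c := (h01 x).2
  have d := (h01 y).1
  have e := hanti hxy
  have f := steinAvg_antitone hi hanti hxy
  rw [abs_le]
  constructor <;> linarith

/-! ### The leave-one-out argument for independent sums. -/

lemma abs_taylor_remainder_le {f f' : ℝ → ℝ} (hf : ∀ x, HasDerivAt f (f' x) x) {x y M : ℝ}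
    (hM : ∀ t ∈ Set.uIcc y (x + y), |f' t - f' y| ≤ M) :
    |x ^ 2 * f' y - x * (f (x + y) - f y)| ≤ M * x ^ 2 := by
  have h := (convex_uIcc y (x + y)).norm_image_sub_le_of_norm_hasDerivWithin_le
    (f := fun t => f t - f' y * t) (f' := fun t => f' t - f' y) (C := M)
    (fun t _ => ((hf t).fun_sub ((hasDerivAt_id' t).const_mul (f' y))).hasDerivWithinAt.congr_deriv
      (by ring)) hM Set.left_mem_uIcc Set.right_mem_uIcc
  rw [Real.norm_eq_abs, Real.norm_eq_abs, add_sub_cancel_right] at h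
  have e : x ^ 2 * f' y - x * (f (x + y) - f y)
      = -(x * (f (x + y) - f' y * (x + y) - (f y - f' y * y))) := by ring
  rw [e, abs_neg, abs_mul, ← sq_abs x]
  nlinarith [mul_le_mul_of_nonneg_left h (abs_nonneg x)]

section IndependentSum

variable {Ω : Type*} [MeasurableSpace Ω] {μ : Measure Ω} [IsProbabilityMeasure μ]

lemma integral_abs_le_sqrt {X : Ω → ℝ} (hX : MemLp X 2 μ) :
    ∫ ω, |X ω| ∂μ ≤ √(∫ ω, X ω ^ 2 ∂μ) := by
  have h := variance_nonneg |X| μ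
  rw [variance_eq_sub hX.abs] at h
  apply Real.le_sqrt_of_sq_le
  simpa [sq_abs] using h

/-- One step of the leave-one-out argument. -/
lemma abs_stein_step_le {f f' : ℝ → ℝ} (hf : ∀ x, HasDerivAt f (f' x) x) {B c : ℝ} {K : ℝ≥0}
    (hB : ∀ x, |f x| ≤ B) (hc : ∀ x y, |f' x - f' y| ≤ c) (hK : LipschitzWith K f')
    {X Y : Ω → ℝ} (hX : Measurable X) (hY : Measurable Y) (hXY : IndepFun X Y μ)
    (hX2 : MemLp X 2 μ) (hX0 : ∫ ω, X ω ∂μ = 0) {ε : ℝ} (hε : 0 < ε) :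
    |(∫ ω, X ω ^ 2 ∂μ) * ∫ ω, f' (X ω + Y ω) ∂μ - ∫ ω, X ω * f (X ω + Y ω) ∂μ|
      ≤ c * ∫ ω in {ω | ε < |X ω|}, X ω ^ 2 ∂μ
        + K * (ε + √(∫ ω, X ω ^ 2 ∂μ)) * ∫ ω, X ω ^ 2 ∂μ := by
  have hfc : Continuous f := continuous_iff_continuousAt.2 fun x => (hf x).continuousAt
  have hfm : Measurable f := hfc.measurable
  have hfm' : Measurable f' := hK.continuous.measurable
  have hc0 : 0 ≤ c := (abs_nonneg _).trans (hc 0 0)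
  have hD : ∀ x, ‖f' x‖ ≤ |f' 0| + c := fun x => by
    have := abs_sub_abs_le_abs_sub (f' x) (f' 0)
    rw [Real.norm_eq_abs]
    linarith [hc x 0]
  have iX : Integrable X μ := hX2.integrable one_le_two
  have iX2 : Integrable (fun ω => X ω ^ 2) μ := hX2.integrable_sq
  have bdd : ∀ {U : Ω → ℝ} {g : ℝ → ℝ} {D : ℝ} {Z : Ω → ℝ}, Integrable U μ → Measurable g →
      Measurable Z → (∀ x, ‖g x‖ ≤ D) → Integrable (fun ω => U ω * g (Z ω)) μ :=
    fun hU hg hZ hD => hU.mul_bdd (hg.comp hZ).aestronglyMeasurable (ae_of_all _ fun ω => hD _)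
  have hXY' : Measurable fun ω => X ω + Y ω := hX.add hY
  have i1 : Integrable (fun ω => f' (X ω + Y ω)) μ := by
    simpa using bdd (integrable_const (1 : ℝ)) hfm' hXY' hD
  have i2 : Integrable (fun ω => f' (Y ω)) μ := by
    simpa using bdd (integrable_const (1 : ℝ)) hfm' hY hD
  have i3 : Integrable (fun ω => X ω * f (X ω + Y ω)) μ := bdd iX hfm hXY' hB
  have i4 : Integrable (fun ω => X ω * f (Y ω)) μ := bdd iX hfm hY hB
  have i5 : Integrable (fun ω => X ω ^ 2 * f' (Y ω)) μ := bdd iX2 hfm' hY hD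
  -- Independence and centring allow f(Y) to be subtracted at no cost, which turns X f(X + Y) into a
  -- first-order increment.
  have e1 : ∫ ω, X ω * f (Y ω) ∂μ = 0 := by
    have := hXY.integral_comp_mul_comp (f := id) (g := f) hX.aemeasurable hY.aemeasurable
      aestronglyMeasurable_id hfm.aestronglyMeasurable
    simpa [hX0] using this
  have e2 : ∫ ω, X ω ^ 2 * f' (Y ω) ∂μ = (∫ ω, X ω ^ 2 ∂μ) * ∫ ω, f' (Y ω) ∂μ := by
    have := hXY.integral_comp_mul_comp (f := fun x => x ^ 2) (g := f') hX.aemeasurable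
      hY.aemeasurable (by fun_prop) hfm'.aestronglyMeasurable
    simpa using this
  have hs : MeasurableSet {ω | ε < |X ω|} := measurableSet_lt measurable_const hX.abs
  have r1 : |∫ ω, (X ω ^ 2 * f' (Y ω) - X ω * (f (X ω + Y ω) - f (Y ω))) ∂μ|
      ≤ c * ∫ ω in {ω | ε < |X ω|}, X ω ^ 2 ∂μ + K * ε * ∫ ω, X ω ^ 2 ∂μ := by
    rw [← integral_indicator hs, ← integral_const_mul, ← integral_const_mul,
      ← integral_add ((iX2.indicator hs).const_mul c) (iX2.const_mul _), ← Real.norm_eq_abs]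
    refine norm_integral_le_of_norm_le
      (((iX2.indicator hs).const_mul c).add (iX2.const_mul _)) (ae_of_all _ fun ω => ?_)
    -- Large jumps are controlled by the oscillation of f' alone, small ones by its Lipschitz
    -- constant times ε.
    by_cases hω : ε < |X ω|
    · have h1 := abs_taylor_remainder_le hf (x := X ω) (y := Y ω) fun t _ => hc t (Y ω)
      rw [Set.indicator_of_mem (by exact hω), Real.norm_eq_abs]
      have : 0 ≤ K * ε * X ω ^ 2 := by positivity
      linarith
    · have h1 := abs_taylor_remainder_le hf (x := X ω) (y := Y ω) (M := K * ε) fun t ht => by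
        have h2 := hK.dist_le_mul t (Y ω)
        rw [Real.dist_eq, Real.dist_eq] at h2
        refine h2.trans (mul_le_mul_of_nonneg_left ?_ K.coe_nonneg)
        have h3 := Set.abs_sub_left_of_mem_uIcc ht
        rw [add_sub_cancel_right] at h3
        exact h3.trans (not_lt.1 hω)
      rw [Set.indicator_of_notMem (by exact hω), Real.norm_eq_abs]
      linarith
  -- Putting the omitted summand back into f' costs K E|X|, at most K times the standard deviation.
  have r2 : |∫ ω, (f' (X ω + Y ω) - f' (Y ω)) ∂μ| ≤ K * √(∫ ω, X ω ^ 2 ∂μ) := by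
    refine le_trans ?_ (mul_le_mul_of_nonneg_left (integral_abs_le_sqrt hX2) K.coe_nonneg)
    rw [← integral_const_mul, ← Real.norm_eq_abs]
    refine norm_integral_le_of_norm_le (iX.abs.const_mul _) (ae_of_all _ fun ω => ?_)
    have h2 := hK.dist_le_mul (X ω + Y ω) (Y ω)
    rwa [Real.dist_eq, Real.dist_eq, add_sub_cancel_right] at h2
  have hσ : 0 ≤ ∫ ω, X ω ^ 2 ∂μ := integral_nonneg fun ω => sq_nonneg _
  have r3 := mul_le_mul_of_nonneg_left r2 hσ
  rw [← abs_of_nonneg hσ, ← abs_mul, abs_of_nonneg hσ] at r3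
  rw [integral_sub i1 i2] at r3
  have e3 : ∫ ω, (X ω ^ 2 * f' (Y ω) - X ω * (f (X ω + Y ω) - f (Y ω))) ∂μ
      = (∫ ω, X ω ^ 2 ∂μ) * ∫ ω, f' (Y ω) ∂μ - ∫ ω, X ω * f (X ω + Y ω) ∂μ := by
    simp_rw [mul_sub]
    rw [integral_sub i5 (by exact i3.sub i4), integral_sub i3 i4, e1, e2, sub_zero]
  rw [e3] at r1
  have e4 : (∫ ω, X ω ^ 2 ∂μ) * ∫ ω, f' (X ω + Y ω) ∂μ - ∫ ω, X ω * f (X ω + Y ω) ∂μ =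
      (∫ ω, X ω ^ 2 ∂μ) * (∫ ω, f' (X ω + Y ω) ∂μ - ∫ ω, f' (Y ω) ∂μ)
      + ((∫ ω, X ω ^ 2 ∂μ) * ∫ ω, f' (Y ω) ∂μ - ∫ ω, X ω * f (X ω + Y ω) ∂μ) := by ring
  rw [e4]
  refine (abs_add_le _ _).trans ?_
  linarith

/-- Stein's method for a sum of independent centred variables with total variance one. -/
lemma abs_integral_stein_sum_le {ι : Type*} [Fintype ι] {X : ι → Ω → ℝ}
    (hm : ∀ k, Measurable (X k)) (hind : iIndepFun X μ) (h2 : ∀ k, MemLp (X k) 2 μ)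
    (h0 : ∀ k, ∫ ω, X k ω ∂μ = 0) (h1 : ∑ k, ∫ ω, X k ω ^ 2 ∂μ = 1)
    {f f' : ℝ → ℝ} (hf : ∀ x, HasDerivAt f (f' x) x) {B c : ℝ} {K : ℝ≥0}
    (hB : ∀ x, |f x| ≤ B) (hc : ∀ x y, |f' x - f' y| ≤ c) (hK : LipschitzWith K f')
    {ε v : ℝ} (hε : 0 < ε) (hv : ∀ k, ∫ ω, X k ω ^ 2 ∂μ ≤ v) :
    |∫ ω, (f' (∑ k, X k ω) - (∑ k, X k ω) * f (∑ k, X k ω)) ∂μ|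
      ≤ c * ∑ k, ∫ ω in {ω | ε < |X k ω|}, X k ω ^ 2 ∂μ + K * (ε + √v) := by
  classical
  have hfm : Measurable f :=
    (continuous_iff_continuousAt.2 fun x => (hf x).continuousAt).measurable
  have hfm' : Measurable f' := hK.continuous.measurable
  have hS : Measurable fun ω => ∑ k, X k ω := Finset.measurable_sum _ fun k _ => hm k
  have hD : ∀ x, ‖f' x‖ ≤ |f' 0| + c := fun x => by
    have := abs_sub_abs_le_abs_sub (f' x) (f' 0)
    rw [Real.norm_eq_abs]
    linarith [hc x 0]
  have i1 : Integrable (fun ω => f' (∑ k, X k ω)) μ :=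
    Integrable.of_bound (hfm'.comp hS).aestronglyMeasurable _ (ae_of_all _ fun ω => hD _)
  have i2 : ∀ k, Integrable (fun ω => X k ω * f (∑ k, X k ω)) μ := fun k =>
    ((h2 k).integrable one_le_two).mul_bdd (hfm.comp hS).aestronglyMeasurable
      (ae_of_all _ fun ω => hB _)
  have step : ∀ k, |(∫ ω, X k ω ^ 2 ∂μ) * ∫ ω, f' (∑ k, X k ω) ∂μ
      - ∫ ω, X k ω * f (∑ k, X k ω) ∂μ|
      ≤ c * ∫ ω in {ω | ε < |X k ω|}, X k ω ^ 2 ∂μ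
        + K * (ε + √v) * ∫ ω, X k ω ^ 2 ∂μ := fun k => by
    have hXY : IndepFun (X k) (fun ω => ∑ j ∈ Finset.univ.erase k, X j ω) μ := by
      have := (hind.indepFun_finsetSum_of_notMem hm (Finset.notMem_erase k Finset.univ)).symm
      convert this using 1
      funext ω
      simp
    have h := abs_stein_step_le hf hB hc hK (hm k)
      (Finset.measurable_sum _ fun j _ => hm j) hXY (h2 k) (h0 k) hε
    have es : ∀ ω, X k ω + ∑ j ∈ Finset.univ.erase k, X j ω = ∑ j, X j ω := fun ω =>
      Finset.add_sum_erase _ (fun j => X j ω) (Finset.mem_univ k)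
    simp only [es] at h
    refine h.trans ?_
    have : 0 ≤ ∫ ω, X k ω ^ 2 ∂μ := integral_nonneg fun ω => sq_nonneg _
    have := Real.sqrt_le_sqrt (hv k)
    gcongr
  have e : ∫ ω, (f' (∑ k, X k ω) - (∑ k, X k ω) * f (∑ k, X k ω)) ∂μ
      = ∑ k, ((∫ ω, X k ω ^ 2 ∂μ) * ∫ ω, f' (∑ k, X k ω) ∂μ
      - ∫ ω, X k ω * f (∑ k, X k ω) ∂μ) := by
    simp_rw [Finset.sum_mul]
    rw [integral_sub i1 (integrable_finsetSum _ fun k _ => i2 k),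
      integral_finsetSum _ fun k _ => i2 k, Finset.sum_sub_distrib, ← Finset.sum_mul, h1, one_mul]
  rw [e]
  refine (Finset.abs_sum_le_sum_abs _ _).trans ((Finset.sum_le_sum fun k _ => step k).trans ?_)
  rw [Finset.sum_add_distrib, ← Finset.mul_sum, ← Finset.mul_sum, h1, mul_one]

lemma abs_integral_sum_sub_normal_le {ι : Type*} [Fintype ι] {X : ι → Ω → ℝ}
    (hm : ∀ k, Measurable (X k)) (hind : iIndepFun X μ) (h2 : ∀ k, MemLp (X k) 2 μ)
    (h0 : ∀ k, ∫ ω, X k ω ∂μ = 0) (h1 : ∑ k, ∫ ω, X k ω ^ 2 ∂μ = 1)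
    {h : ℝ → ℝ} {L : ℝ≥0} (hh : LipschitzWith L h) {c : ℝ}
    (hc : ∀ x y, |steinDeriv h x - steinDeriv h y| ≤ c)
    {ε v : ℝ} (hε : 0 < ε) (hv : ∀ k, ∫ ω, X k ω ^ 2 ∂μ ≤ v) :
    |∫ x, h x ∂(μ.map fun ω => ∑ k, X k ω) - ∫ x, h x ∂normalLaw|
      ≤ c * ∑ k, ∫ ω in {ω | ε < |X k ω|}, X k ω ^ 2 ∂μ + 6 * L * (ε + √v) := by
  have hi := integrable_normalLaw_of_lipschitzWith hh
  have hS : Measurable fun ω => ∑ k, X k ω := Finset.measurable_sum _ fun k _ => hm k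
  have iS : Integrable (fun ω => ∑ k, X k ω) μ :=
    integrable_finsetSum _ fun k _ => (h2 k).integrable one_le_two
  have : IsProbabilityMeasure (μ.map fun ω => ∑ k, X k ω) :=
    Measure.isProbabilityMeasure_map hS.aemeasurable
  have ih : Integrable (fun ω => h (∑ k, X k ω)) μ := by
    have := integrable_of_lipschitzWith (ν := μ.map fun ω => ∑ k, X k ω)
      ((integrable_map_measure aestronglyMeasurable_id hS.aemeasurable).2 iS) hh
    exact this.comp_measurable hS
  have key := abs_integral_stein_sum_le hm hind h2 h0 h1 (hasDerivAt_steinSol hh.continuous hi)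
    (abs_steinSol_le hh) hc (lipschitzWith_steinDeriv hh) hε hv
  have e : ∫ ω, (steinDeriv h (∑ k, X k ω) - (∑ k, X k ω) * steinSol h (∑ k, X k ω)) ∂μ
      = ∫ x, h x ∂(μ.map fun ω => ∑ k, X k ω) - ∫ x, h x ∂normalLaw := by
    simp only [steinDeriv, add_sub_cancel_right]
    rw [integral_sub ih (integrable_const _),
      integral_map hS.aemeasurable hh.continuous.aestronglyMeasurable]
    simp
  rw [e] at key
  exact_mod_cast key

end IndependentSum

/-! ### Quantile coupling and Kantorovich duality on the line. -/

/-- The quantile function of a law on the line. -/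
noncomputable def quantile (P : Measure ℝ) (u : ℝ) : ℝ := sInf {x | u ≤ cdf P x}

/-- The uniform law on the unit interval. -/
noncomputable abbrev unitUniform : Measure ℝ := volume.restrict (Set.Ioo (0 : ℝ) 1)

instance : IsProbabilityMeasure unitUniform := ⟨by simp⟩

/-- The infimum is attained by right continuity of the distribution function. -/
lemma quantile_le_iff (P : Measure ℝ) {u : ℝ} (hu : u ∈ Set.Ioo (0 : ℝ) 1) (x : ℝ) :
    quantile P u ≤ x ↔ u ≤ cdf P x := by
  have hb : BddBelow {x | u ≤ cdf P x} := by
    obtain ⟨a, ha⟩ := ((tendsto_cdf_atBot P).eventually (gt_mem_nhds hu.1)).exists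
    exact ⟨a, fun y hy => le_of_not_gt fun hya =>
      absurd (hy.trans (monotone_cdf P hya.le)) (not_le.2 ha)⟩
  have hne : {x | u ≤ cdf P x}.Nonempty := by
    obtain ⟨a, ha⟩ := ((tendsto_cdf_atTop P).eventually (lt_mem_nhds hu.2)).exists
    exact ⟨a, ha.le⟩
  refine ⟨fun h => ?_, fun h => csInf_le hb h⟩
  have hgt : ∀ y, quantile P u < y → u ≤ cdf P y := fun y hy => by
    obtain ⟨z, hz, hzy⟩ := exists_lt_of_csInf_lt hne hy
    exact le_trans hz (monotone_cdf P hzy.le)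
  have hq : u ≤ cdf P (quantile P u) := by
    have ht : Tendsto (cdf P) (𝓝[>] quantile P u) (𝓝 (cdf P (quantile P u))) :=
      ((cdf P).right_continuous (quantile P u)).mono Set.Ioi_subset_Ici_self
    exact ge_of_tendsto ht (eventually_mem_nhdsWithin.mono fun y hy => hgt y hy)
  exact hq.trans (monotone_cdf P h)

lemma aemeasurable_quantile (P : Measure ℝ) : AEMeasurable (quantile P) unitUniform := by
  refine aemeasurable_restrict_of_monotoneOn measurableSet_Ioo fun u hu v hv huv => ?_
  exact (quantile_le_iff P hu _).2 (huv.trans ((quantile_le_iff P hv _).1 le_rfl))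

lemma map_quantile (P : Measure ℝ) [IsProbabilityMeasure P] :
    unitUniform.map (quantile P) = P := by
  have : IsProbabilityMeasure (unitUniform.map (quantile P)) :=
    Measure.isProbabilityMeasure_map (aemeasurable_quantile P)
  refine Measure.ext_of_Iic _ _ fun x => ?_
  rw [Measure.map_apply_of_aemeasurable (aemeasurable_quantile P) measurableSet_Iic,
    Measure.restrict_apply' measurableSet_Ioo]
  have e : quantile P ⁻¹' Set.Iic x ∩ Set.Ioo 0 1 = Set.Iic (cdf P x) ∩ Set.Ioo 0 1 := by
    ext u
    exact and_congr_left fun hu => quantile_le_iff P hu x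
  rw [e, ← ofReal_cdf]
  have h0 := cdf_nonneg P x
  rcases (cdf_le_one P x).lt_or_eq with h1 | h1
  · have : Set.Iic (cdf P x) ∩ Set.Ioo 0 1 = Set.Ioc 0 (cdf P x) := by
      ext u
      simp only [Set.mem_inter_iff, Set.mem_Iic, Set.mem_Ioo, Set.mem_Ioc]
      constructor
      · rintro ⟨a, b, c⟩
        exact ⟨b, a⟩
      · rintro ⟨b, a⟩
        exact ⟨a, b, a.trans_lt h1⟩
    rw [this, Real.volume_Ioc, sub_zero]
  · rw [h1, Set.inter_eq_right.2 fun u hu => hu.2.le]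
    simp

/-- On the line the quantile coupling is optimal: the sign of the difference of the distribution
functions is the derivative of a Kantorovich potential. -/
lemma exists_lipschitz_wasserstein_le (P Q : Measure ℝ) [IsProbabilityMeasure P]
    [IsProbabilityMeasure Q] (hP : Integrable (fun x : ℝ => x) P)
    (hQ : Integrable (fun x : ℝ => x) Q) :
    ∃ h : ℝ → ℝ, LipschitzWith 1 h ∧
      wasserstein P Q ≤ ENNReal.ofReal (∫ x, h x ∂Q - ∫ x, h x ∂P) := by
  set s : ℝ → ℝ := fun t => if cdf Q t < cdf P t then 1 else -1 with hs
  have hsm : Measurable s := Measurable.ite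
    (measurableSet_lt (monotone_cdf Q).measurable (monotone_cdf P).measurable)
    measurable_const measurable_const
  have hsb : ∀ t, ‖s t‖ ≤ 1 := fun t => by
    simp only [hs]
    split_ifs <;> simp
  have hsi : ∀ a b, IntervalIntegrable s volume a b := fun a b =>
    (intervalIntegrable_const (c := (1 : ℝ))).mono_fun hsm.aestronglyMeasurable
      (ae_of_all _ fun t => by simpa using hsb t)
  set h : ℝ → ℝ := fun y => ∫ t in (0 : ℝ)..y, s t with hh
  have hsub : ∀ a b, h b - h a = ∫ t in a..b, s t := fun a b =>
    intervalIntegral.integral_interval_sub_left (hsi _ _) (hsi _ _)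
  have hL : LipschitzWith 1 h := LipschitzWith.of_dist_le_mul fun x y => by
    rw [Real.dist_eq, hsub, Real.dist_eq, NNReal.coe_one]
    exact intervalIntegral.norm_integral_le_of_norm_le_const fun t _ => hsb t
  refine ⟨h, hL, ?_⟩
  have mP := aemeasurable_quantile P
  have mQ := aemeasurable_quantile Q
  -- Between the two u-quantiles, u separates the distribution functions, so s has constant sign and
  -- h realises the full distance. Left-closed intervals are used below because they match
  -- `quantile_le_iff`.
  have hpot : ∀ u ∈ Set.Ioo (0 : ℝ) 1,
      |quantile P u - quantile Q u| = h (quantile Q u) - h (quantile P u) := fun u hu => by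
    rw [hsub]
    rcases le_total (quantile P u) (quantile Q u) with hle | hle
    · have : ∫ t in quantile P u..quantile Q u, s t
          = ∫ t in quantile P u..quantile Q u, (1 : ℝ) := by
        rw [intervalIntegral.integral_of_le hle, intervalIntegral.integral_of_le hle,
          ← integral_Ico_eq_integral_Ioc, ← integral_Ico_eq_integral_Ioc]
        refine setIntegral_congr_fun measurableSet_Ico fun t ht => if_pos ?_
        have h1 := (quantile_le_iff P hu t).1 ht.1
        have h2 := not_le.1 (mt (quantile_le_iff Q hu t).2 (not_le.2 ht.2))
        exact h2.trans_le h1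
      rw [this, abs_of_nonpos (by linarith)]
      simp
    · have : ∫ t in quantile Q u..quantile P u, s t
          = ∫ t in quantile Q u..quantile P u, (-1 : ℝ) := by
        rw [intervalIntegral.integral_of_le hle, intervalIntegral.integral_of_le hle,
          ← integral_Ico_eq_integral_Ioc, ← integral_Ico_eq_integral_Ioc]
        refine setIntegral_congr_fun measurableSet_Ico fun t ht => if_neg ?_
        have h1 := (quantile_le_iff Q hu t).1 ht.1
        have h2 := not_le.1 (mt (quantile_le_iff P hu t).2 (not_le.2 ht.2))
        exact not_lt.2 (h2.le.trans h1)
      rw [intervalIntegral.integral_symm, this, abs_of_nonneg (by linarith)]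
      simp
  have iP : Integrable (fun u => h (quantile P u)) unitUniform :=
    (integrable_map_measure hL.continuous.aestronglyMeasurable mP).1
      (by rw [map_quantile]; exact integrable_of_lipschitzWith hP hL)
  have iQ : Integrable (fun u => h (quantile Q u)) unitUniform :=
    (integrable_map_measure hL.continuous.aestronglyMeasurable mQ).1
      (by rw [map_quantile]; exact integrable_of_lipschitzWith hQ hL)
  have eP : ∫ x, h x ∂P = ∫ u, h (quantile P u) ∂unitUniform := by
    conv_lhs => rw [← map_quantile P]
    exact integral_map mP hL.continuous.aestronglyMeasurable
  have eQ : ∫ x, h x ∂Q = ∫ u, h (quantile Q u) ∂unitUniform := by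
    conv_lhs => rw [← map_quantile Q]
    exact integral_map mQ hL.continuous.aestronglyMeasurable
  have mPQ := mP.prodMk mQ
  have marg : (unitUniform.map fun u => (quantile P u, quantile Q u)).map Prod.fst = P ∧
      (unitUniform.map fun u => (quantile P u, quantile Q u)).map Prod.snd = Q := by
    constructor
    · rw [AEMeasurable.map_map_of_aemeasurable measurable_fst.aemeasurable mPQ]
      exact map_quantile P
    · rw [AEMeasurable.map_map_of_aemeasurable measurable_snd.aemeasurable mPQ]
      exact map_quantile Q
  refine le_trans (iInf₂_le (unitUniform.map fun u => (quantile P u, quantile Q u)) marg) ?_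
  rw [lintegral_map' (by fun_prop) mPQ, eP, eQ, ← integral_sub iQ iP]
  have hae : ∀ᵐ u ∂unitUniform,
      |quantile P u - quantile Q u| = h (quantile Q u) - h (quantile P u) :=
    (ae_restrict_mem measurableSet_Ioo).mono hpot
  rw [ofReal_integral_eq_lintegral_ofReal (by exact iQ.sub iP)
    (hae.mono fun u hu => by simp only [Pi.zero_apply]; rw [← hu]; positivity)]
  refine le_of_eq (lintegral_congr_ae (hae.mono fun u hu => ?_))
  simp only
  rw [edist_dist, Real.dist_eq, hu]

/-! ### Passage to the limit along the array. -/

section Array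

variable {Ω : Type*} [MeasurableSpace Ω] {μ : Measure Ω}
  {X : (n : ℕ) → Fin n → Ω → ℝ}

lemma IsStandardTriangularArray.measurable_sum (hX : IsStandardTriangularArray X μ) (n : ℕ) :
    Measurable fun ω => ∑ k, X n k ω :=
  Finset.measurable_sum _ fun k _ => hX.measurable n k

lemma le_mul_of_forall_le_ofReal_add {a b : ℝ≥0∞} {C : ℝ≥0} (hb : b ≠ ∞)
    (h : ∀ η : ℝ, 0 < η → a ≤ ENNReal.ofReal (C * b.toReal + η)) : a ≤ C * b := by
  refine ENNReal.le_of_forall_pos_le_add fun η hη _ => (h η hη).trans_eq ?_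
  rw [ENNReal.ofReal_add (by positivity) η.coe_nonneg, ENNReal.ofReal_mul C.coe_nonneg,
    ENNReal.ofReal_toReal hb, ENNReal.ofReal_coe_nnreal, ENNReal.ofReal_coe_nnreal]

lemma limsupDist_le {d : Measure ℝ → Measure ℝ → ℝ≥0∞} {ξ : Ω → ℝ} (hξ : HasLaw ξ normalLaw μ)
    {C : ℝ≥0} (hfin : lindebergIndex X μ ≠ ∞)
    (h : ∀ η : ℝ, 0 < η → ∀ᶠ n : ℕ in atTop, d normalLaw (μ.map fun ω => ∑ k : Fin n, X n k ω)
      ≤ ENNReal.ofReal (C * (lindebergIndex X μ).toReal + η)) :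
    limsupDist d ξ X μ ≤ C * lindebergIndex X μ := by
  refine le_mul_of_forall_le_ofReal_add hfin fun η hη => ?_
  rw [limsupDist, hξ.map_eq]
  exact limsup_le_of_le (h := h η hη)

variable [IsProbabilityMeasure μ]

lemma IsStandardTriangularArray.isProbabilityMeasure_map_sum
    (hX : IsStandardTriangularArray X μ) (n : ℕ) :
    IsProbabilityMeasure (μ.map fun ω => ∑ k, X n k ω) :=
  Measure.isProbabilityMeasure_map (hX.measurable_sum n).aemeasurable

lemma IsStandardTriangularArray.integrable_id_map_sum
    (hX : IsStandardTriangularArray X μ) (n : ℕ) :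
    Integrable (fun x : ℝ => x) (μ.map fun ω => ∑ k, X n k ω) := by
  have h : Integrable (fun ω => ∑ k, X n k ω) μ :=
    integrable_finsetSum _ fun k _ => (hX.memLp_two n k).integrable one_le_two
  exact (integrable_map_measure aestronglyMeasurable_id (hX.measurable_sum n).aemeasurable).2 h

/-- The uniform asymptotic bound given by Stein's method: the oscillation of the derivative of the
Stein solution times the Lindeberg index. -/
lemma eventually_abs_integral_sub_le (hX : IsStandardTriangularArray X μ)
    (hF : FellerCondition X μ) (hfin : lindebergIndex X μ ≠ ∞) {c η : ℝ} (hc : 0 ≤ c) (hη : 0 < η)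
    (L : ℝ≥0) : ∀ᶠ n in atTop, ∀ h : ℝ → ℝ, LipschitzWith L h →
      (∀ x y, |steinDeriv h x - steinDeriv h y| ≤ c) →
      |∫ x, h x ∂(μ.map fun ω => ∑ k, X n k ω) - ∫ x, h x ∂normalLaw|
        ≤ c * (lindebergIndex X μ).toReal + η := by
  set ℓ := (lindebergIndex X μ).toReal with hℓ
  have hℓ0 : 0 ≤ ℓ := ENNReal.toReal_nonneg
  -- The slack η is split in three: truncation level, excess over the limsup, and Feller's maximum.
  -- The added ones avoid division by zero.
  set ε : ℝ := η / 3 / (6 * (L + 1)) with hε_def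
  have hε : 0 < ε := by positivity
  have hεL : 6 * L * ε ≤ η / 3 := by
    have : 6 * (L + 1) * ε = η / 3 := by rw [hε_def]; field_simp
    nlinarith
  set r : ℝ := η / 3 / (c + 1) with hr_def
  have hr : 0 < r := by positivity
  have hcr : c * r ≤ η / 3 := by
    have : (c + 1) * r = η / 3 := by rw [hr_def]; field_simp
    linarith
  have ev1 : ∀ᶠ n : ℕ in atTop, ∑ k : Fin n, ∫⁻ ω in {ω | ε < |X n k ω|},
      ENNReal.ofReal (X n k ω ^ 2) ∂μ < ENNReal.ofReal (ℓ + r) := by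
    refine eventually_lt_of_limsup_lt (lt_of_le_of_lt
      (le_iSup₂ (f := fun (ε : ℝ) (_ : 0 < ε) => limsup (fun n : ℕ =>
        ∑ k : Fin n, ∫⁻ ω in {ω | ε < |X n k ω|}, ENNReal.ofReal (X n k ω ^ 2) ∂μ) atTop) ε hε) ?_)
    change lindebergIndex X μ < _
    rw [← ENNReal.ofReal_toReal hfin, ← hℓ]
    exact (ENNReal.ofReal_lt_ofReal_iff (by linarith)).2 (by linarith)
  have ev2 : ∀ᶠ n : ℕ in atTop, 6 * L * √(⨆ k : Fin n, ∫ ω, X n k ω ^ 2 ∂μ) < η / 3 := by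
    have ht : Tendsto (fun n : ℕ => 6 * L * √(⨆ k : Fin n, ∫ ω, X n k ω ^ 2 ∂μ)) atTop (𝓝 0) := by
      have := (Real.continuous_sqrt.tendsto 0).comp hF
      rw [Real.sqrt_zero] at this
      simpa using this.const_mul (6 * (L : ℝ))
    exact ht.eventually (gt_mem_nhds (by positivity))
  filter_upwards [ev1, ev2, eventually_ge_atTop 1] with n h1 h2 hn h hh hosc
  have key := abs_integral_sum_sub_normal_le (hX.measurable n) (hX.indep n) (hX.memLp_two n)
    (hX.mean_eq_zero n) (hX.sum_second_moment n hn) hh hosc hε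
    (fun k => le_ciSup (f := fun k => ∫ ω, X n k ω ^ 2 ∂μ) (Set.finite_range _).bddAbove k)
  have e : ENNReal.ofReal (∑ k : Fin n, ∫ ω in {ω | ε < |X n k ω|}, X n k ω ^ 2 ∂μ)
      = ∑ k : Fin n, ∫⁻ ω in {ω | ε < |X n k ω|}, ENNReal.ofReal (X n k ω ^ 2) ∂μ := by
    rw [ENNReal.ofReal_sum_of_nonneg fun k _ => integral_nonneg fun ω => sq_nonneg _]
    refine Finset.sum_congr rfl fun k _ => ?_
    exact ofReal_integral_eq_lintegral_ofReal (hX.memLp_two n k).integrable_sq.integrableOn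
      (ae_of_all _ fun ω => sq_nonneg _)
  rw [← e, ENNReal.ofReal_lt_ofReal_iff (by linarith)] at h1
  have h3 := mul_le_mul_of_nonneg_left h1.le hc
  linarith

/-! ### Kolmogorov distance: ramp functions. -/

/-- The function equal to `1` up to `a`, to `0` from `a + δ` on, and affine in between. -/
noncomputable def ramp (a δ t : ℝ) : ℝ := max 0 (min 1 ((a + δ - t) / δ))

lemma ramp_mem_Icc (a δ t : ℝ) : ramp a δ t ∈ Set.Icc (0 : ℝ) 1 :=
  ⟨le_max_left _ _, max_le zero_le_one (min_le_left _ _)⟩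

lemma ramp_antitone (a : ℝ) {δ : ℝ} (hδ : 0 < δ) : Antitone (ramp a δ) := fun x y hxy => by
  unfold ramp
  gcongr

lemma lipschitzWith_ramp (a : ℝ) (δ : ℝ≥0) : LipschitzWith δ⁻¹ (ramp a δ) := by
  have : LipschitzWith δ⁻¹ fun t : ℝ => (a + δ - t) / δ :=
    LipschitzWith.of_dist_le_mul fun x y => by
      rw [Real.dist_eq, Real.dist_eq, ← sub_div, abs_div, NNReal.abs_eq, NNReal.coe_inv,
        sub_sub_sub_cancel_left, abs_sub_comm]
      exact le_of_eq (by ring)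
  exact (this.const_min 1).const_max 0

lemma integral_ramp_le (a : ℝ) {δ : ℝ≥0} (hδ : 0 < δ) (Q : Measure ℝ) [IsProbabilityMeasure Q] :
    Q.real (Set.Iic a) ≤ ∫ t, ramp a δ t ∂Q ∧ ∫ t, ramp a δ t ∂Q ≤ Q.real (Set.Iic (a + δ)) := by
  have hδ' : (0 : ℝ) < δ := hδ
  have hi : Integrable (ramp a δ) Q :=
    Integrable.of_bound (lipschitzWith_ramp a δ).continuous.aestronglyMeasurable 1
      (ae_of_all _ fun t => by
        rw [Real.norm_eq_abs, abs_of_nonneg (ramp_mem_Icc a δ t).1]; exact (ramp_mem_Icc a δ t).2)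
  rw [← integral_indicator_one measurableSet_Iic, ← integral_indicator_one measurableSet_Iic]
  constructor
  · refine integral_mono ((integrable_const 1).indicator measurableSet_Iic) hi fun t => ?_
    by_cases ht : t ≤ a
    · rw [Set.indicator_of_mem (by exact ht)]
      exact le_max_of_le_right (le_min le_rfl ((one_le_div hδ').2 (by linarith)))
    · rw [Set.indicator_of_notMem (by exact ht)]
      exact (ramp_mem_Icc a δ t).1
  · refine integral_mono hi ((integrable_const 1).indicator measurableSet_Iic) fun t => ?_
    by_cases ht : t ≤ a + δ
    · rw [Set.indicator_of_mem (by exact ht)]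
      exact (ramp_mem_Icc a δ t).2
    · rw [Set.indicator_of_notMem (by exact ht)]
      exact max_le le_rfl ((min_le_right _ _).trans
        (div_nonpos_of_nonpos_of_nonneg (by linarith) hδ'.le))

lemma normalLaw_real_Iic_add_le (a : ℝ) {δ : ℝ} (hδ : 0 ≤ δ) :
    normalLaw.real (Set.Iic (a + δ)) ≤ normalLaw.real (Set.Iic a) + δ := by
  rw [normalLaw_real_Iic, normalLaw_real_Iic]
  have h := (convex_univ (𝕜 := ℝ) (E := ℝ)).norm_image_sub_le_of_norm_hasDerivWithin_le
    (f := normalTail) (C := 1) (fun x _ => (hasDerivAt_normalTail x).hasDerivWithinAt)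
    (fun x _ => by
      rw [norm_neg, Real.norm_eq_abs, abs_of_pos (normalPdf_pos x)]
      exact normalPdf_le_one x) (Set.mem_univ a) (Set.mem_univ (a + δ))
  rw [Real.norm_eq_abs, Real.norm_eq_abs, add_sub_cancel_left, abs_of_nonneg hδ, one_mul] at h
  linarith [(abs_le.1 h).1]

lemma limsupDist_kolmogorov_le {ξ : Ω → ℝ} (hξ : HasLaw ξ normalLaw μ)
    (hX : IsStandardTriangularArray X μ) (hF : FellerCondition X μ)
    (hfin : lindebergIndex X μ ≠ ∞) :
    limsupDist kolmogorov ξ X μ ≤ (1 : ℝ≥0) * lindebergIndex X μ := by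
  refine limsupDist_le hξ hfin fun η hη => ?_
  -- Half of η pays for smoothing, since the normal density is at most one, and half for the Stein
  -- error. The ramps starting at x and at x - δ give the two sides.
  obtain ⟨δ, hδ⟩ : ∃ δ : ℝ≥0, (δ : ℝ) = η / 2 := ⟨⟨η / 2, by positivity⟩, rfl⟩
  have hδ0 : 0 < δ := by rw [← NNReal.coe_pos, hδ]; positivity
  filter_upwards [eventually_abs_integral_sub_le hX hF hfin zero_le_one (half_pos hη) δ⁻¹]
    with n hn
  have := hX.isProbabilityMeasure_map_sum n
  set Q := μ.map fun ω => ∑ k, X n k ω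
  refine iSup_le fun x => ENNReal.ofReal_le_ofReal ?_
  have osc : ∀ a, _ := fun a => abs_le.1 <| hn (ramp a δ) (lipschitzWith_ramp a δ)
    (abs_steinDeriv_sub_le_of_antitone
      (integrable_normalLaw_of_lipschitzWith (lipschitzWith_ramp a δ)) (ramp_mem_Icc a δ)
      (ramp_antitone a hδ0))
  have u1 := integral_ramp_le x hδ0 Q
  have u2 := integral_ramp_le x hδ0 normalLaw
  have u3 := integral_ramp_le (x - δ) hδ0 Q
  have u4 := integral_ramp_le (x - δ) hδ0 normalLaw
  have v1 := normalLaw_real_Iic_add_le x δ.coe_nonneg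
  have v2 := normalLaw_real_Iic_add_le (x - δ) δ.coe_nonneg
  rw [sub_add_cancel] at u3 u4 v2
  have o1 := osc x
  have o2 := osc (x - δ)
  rw [abs_le, NNReal.coe_one]
  constructor <;> linarith [u1.1, u1.2, u2.1, u2.2, u3.1, u3.2, u4.1, u4.2, o1.1, o1.2, o2.1, o2.2]

/-! ### Wasserstein distance: the optimal potential as test function. -/

lemma limsupDist_wasserstein_le {ξ : Ω → ℝ} (hξ : HasLaw ξ normalLaw μ)
    (hX : IsStandardTriangularArray X μ) (hF : FellerCondition X μ)
    (hfin : lindebergIndex X μ ≠ ∞) :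
    limsupDist wasserstein ξ X μ ≤ (8 : ℝ≥0) * lindebergIndex X μ := by
  refine limsupDist_le hξ hfin fun η hη => ?_
  filter_upwards [eventually_abs_integral_sub_le hX hF hfin (c := 8) (by norm_num) hη 1] with n hn
  have := hX.isProbabilityMeasure_map_sum n
  obtain ⟨h, hh, hW⟩ := exists_lipschitz_wasserstein_le normalLaw
    (μ.map fun ω => ∑ k, X n k ω) integrable_id_normalLaw (hX.integrable_id_map_sum n)
  refine hW.trans (ENNReal.ofReal_le_ofReal ((le_abs_self _).trans (hn h hh fun x y => ?_)))
  simpa using abs_steinDeriv_sub_le hh x y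

/-! ### Prokhorov distance: thickened indicators. -/

lemma le_measure_cthickening_add {P Q : Measure ℝ} [IsProbabilityMeasure P]
    [IsProbabilityMeasure Q] {A : Set ℝ} (hA : MeasurableSet A) {r α : ℝ} (hr : 0 < r) (hα : 0 ≤ α)
    (h : |∫ x, (thickenedIndicator hr A x : ℝ) ∂Q - ∫ x, (thickenedIndicator hr A x : ℝ) ∂P| ≤ α) :
    P A ≤ Q (Metric.cthickening r A) + ENNReal.ofReal α := by
  have hc : Continuous fun x => (thickenedIndicator hr A x : ℝ) :=
    NNReal.continuous_coe.comp (thickenedIndicator hr A).continuous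
  have hle : ∀ x, (thickenedIndicator hr A x : ℝ) ≤ 1 := fun x =>
    NNReal.coe_le_one.2 (thickenedIndicator_le_one hr A x)
  have hi : ∀ (R : Measure ℝ) [IsProbabilityMeasure R],
      Integrable (fun x => (thickenedIndicator hr A x : ℝ)) R := fun R _ =>
    Integrable.of_bound hc.aestronglyMeasurable 1 (ae_of_all _ fun x => by
      rw [Real.norm_eq_abs, NNReal.abs_eq]; exact hle x)
  have hT : MeasurableSet (Metric.cthickening r A) := Metric.isClosed_cthickening.measurableSet
  have h1 : P.real A ≤ ∫ x, (thickenedIndicator hr A x : ℝ) ∂P := by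
    rw [← integral_indicator_one hA]
    refine integral_mono ((integrable_const 1).indicator hA) (hi P) fun x => ?_
    by_cases hx : x ∈ A
    · simp [hx, thickenedIndicator_one hr A hx]
    · simp [hx]
  have h2 : ∫ x, (thickenedIndicator hr A x : ℝ) ∂Q ≤ Q.real (Metric.cthickening r A) := by
    rw [← integral_indicator_one hT]
    refine integral_mono (hi Q) ((integrable_const 1).indicator hT) fun x => ?_
    by_cases hx : x ∈ Metric.cthickening r A
    · simpa [hx] using hle x
    · have := thickenedIndicator_zero hr A (x := x)
        fun hx' => hx (Metric.thickening_subset_cthickening r A hx')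
      simp [hx, this]
  rw [← ENNReal.ofReal_toReal (measure_ne_top P A),
    ← ENNReal.ofReal_toReal (measure_ne_top Q (Metric.cthickening r A)),
    ← ENNReal.ofReal_add ENNReal.toReal_nonneg hα]
  apply ENNReal.ofReal_le_ofReal
  change P.real A ≤ Q.real _ + α
  linarith [(abs_le.1 h).1]

lemma limsupDist_prokhorov_le {ξ : Ω → ℝ} (hξ : HasLaw ξ normalLaw μ)
    (hX : IsStandardTriangularArray X μ) (hF : FellerCondition X μ)
    (hfin : lindebergIndex X μ ≠ ∞) {l : ℝ} (hl : 0 < l) :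
    limsupDist (prokhorov l) ξ X μ ≤ (4 : ℝ≥0) * lindebergIndex X μ := by
  refine limsupDist_le hξ hfin fun η hη => ?_
  have hℓ : 0 ≤ (lindebergIndex X μ).toReal := ENNReal.toReal_nonneg
  set α : ℝ := (4 : ℝ≥0) * (lindebergIndex X μ).toReal + η
  have hα : 0 < α := by positivity
  have hr : 0 < l * α := by positivity
  -- The Lipschitz constant 1/(lα) depends neither on n nor on A, so one threshold serves all Borel
  -- sets. The available oscillation bound 2 is relaxed to 4.
  filter_upwards [eventually_abs_integral_sub_le hX hF hfin (c := 4) (by norm_num) hη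
    (l * α).toNNReal⁻¹] with n hn
  have := hX.isProbabilityMeasure_map_sum n
  refine iInf₂_le α ⟨hα, fun A hA => le_measure_cthickening_add hA hr hα.le ?_⟩
  have hL : LipschitzWith (l * α).toNNReal⁻¹ fun x => (thickenedIndicator hr A x : ℝ) :=
    lipschitzWith_thickenedIndicator hr A
  refine hn _ hL fun x y => (abs_steinDeriv_sub_le_of_mem_Icc
    (integrable_normalLaw_of_lipschitzWith hL) (fun t => ⟨NNReal.coe_nonneg _,
      NNReal.coe_le_one.2 (thickenedIndicator_le_one hr A t)⟩) x y).trans (by norm_num)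

end Array

end ApproxCLT

theorem theorem4p7 {Ω : Type*} [MeasurableSpace Ω] (μ : Measure Ω) [IsProbabilityMeasure μ]
    (ξ : Ω → ℝ) (hξ : HasLaw ξ (gaussianReal 0 1) μ)
    (X : (n : ℕ) → Fin n → Ω → ℝ) (hX : ApproxCLT.IsStandardTriangularArray X μ)
    (hF : ApproxCLT.FellerCondition X μ) :
    ApproxCLT.limsupDist ApproxCLT.kolmogorov ξ X μ ≤ 1 * ApproxCLT.lindebergIndex X μ ∧
    ApproxCLT.limsupDist ApproxCLT.wasserstein ξ X μ ≤ 8 * ApproxCLT.lindebergIndex X μ ∧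
    (⨆ (l : ℝ) (_ : 0 < l), ApproxCLT.limsupDist (ApproxCLT.prokhorov l) ξ X μ)
      ≤ 4 * ApproxCLT.lindebergIndex X μ := by
  -- An infinite index makes all three bounds trivial; otherwise its real value can be used.
  by_cases hfin : ApproxCLT.lindebergIndex X μ = ∞
  · simp [hfin, ENNReal.mul_top]
  · refine ⟨?_, ?_, iSup₂_le fun l hl => ?_⟩
    · simpa using ApproxCLT.limsupDist_kolmogorov_le hξ hX hF hfin
    · simpa using ApproxCLT.limsupDist_wasserstein_le hξ hX hF hfin
    · simpa using ApproxCLT.limsupDist_prokhorov_le hξ hX hF hfin hl
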